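/- Let $d\ge 0$ and $n\ge d+2$ be integers, let $\mathcal A=(a_1,\dots,a_n)$ be points of $\mathbb R^d$ and let $C\in\mathbb R^{d\times n}$ be a real matrix with columns $C_1,\dots,C_n\in\mathbb R^d$; write $\mathscr C=(C_1,\dots,C_n)$. Let $n_{\mathcal A}(C)\in\mathbb N\cup\{\infty\}$ be the number of solutions $x\in\mathbb R_{>0}^d$ of the system $$\sum_{j=1}^n c_{ij}\,x^{a_j}=0,\qquad i=1,\dots,d,\qquad\text{where } x^{a}=\prod_{l=1}^d x_l^{a_l}.$$ For a finite family $p=(p_j)_{j\in S}$ of points of $\mathbb R^d$, its corresponding matrix is the $(d+1)\times|S|$ matrix with columns $(1,p_j)$, $j\in S$. Let $A$ and $\bar C$ be the corresponding matrices of $\mathcal A$ and $\mathscr C$. For $J\subset\{1,\dots,n\}$, let $\mathcal A_J=(a_j)_{j\in J}$ and $\mathscr C_J=(C_j)_{j\in J}$, and let $A_J$ and $\bar C_J$ be their corresponding matrices. Terminology. A matrix with $r$ rows is *uniform* if none of its $r\times r$ minors vanishes. A *Gale dual matrix* of a matrix $M\in\mathbb R^{r\times s}$ of rank $r$ is a matrix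 in $\mathbb R^{s\times(s-r)}$ whose columns form a basis of $\ker M$. A matrix is *mixed* if each of its columns contains a strictly positive and a strictly negative entry, and *dominating* if it contains no nonempty square mixed submatrix (rows and columns of the submatrix being chosen arbitrarily). In particular a matrix with no columns is both mixed and dominating. Two matrices of the same size have the same sign pattern if corresponding entries have the same sign in $\{+,-,0\}$. For $I\subset\{1,\dots,n\}$, the matrices $A$ and $C$ are *$I$-compatible* if 1. $A_I$ and $\bar C_I$ admit Gale dual matrices $B$ and $D$, respectively, that are both mixed and dominating and that have the same sign pattern; 2. $\operatorname{conv}(\mathcal A_I)=\operatorname{conv}(\mathcal A)$ and $\operatorname{conv}(\mathscr C_I)=\operatorname{conv}(\mathscr C)$; 3. for each $j\notin I$ there is a subset $J\subset I$ with $|J|=d+1$ such that $a_j\in\operatorname{conv}(\mathcal A_J)$ and $C_j\in\operatorname{conv}(\mathscr C_J)$ (the same $J$ for both). **Theorem.** Suppose that $A$, $C$ and $\bar C$ are uniform, that $0\in\mathbb R_{>0}C_1+\dots+\mathbb R_{>0}C_n$, and that there exists $I\subset\{1,\dots,n\}$ such that $A$ and $C$ are $I$-compatible. Then $n_{\mathcal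 A}(C)>0$. -/

import Mathlib

open scoped BigOperators

/-- A matrix with `r` rows is uniform if none of its maximal (that is, `r × r`) minors vanishes. -/
def IsUniform {r n : ℕ} (M : Matrix (Fin r) (Fin n) ℝ) : Prop :=
  ∀ f : Fin r ↪ Fin n, (M.submatrix id f).det ≠ 0

/-- The matrix of a finite point configuration `p` in `ℝ^d`: its columns are the vectors
`(1, p j)`. -/
def configMatrix {d : ℕ} {ι : Type*} (p : ι → Fin d → ℝ) : Matrix (Fin (d + 1)) ι ℝ :=
  Matrix.of fun i j => (Fin.cons 1 (p j) : Fin (d + 1) → ℝ) i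

/-- The columns of a matrix `C ∈ ℝ^{d × n}`, as a point configuration in `ℝ^d`. -/
def colConfig {d n : ℕ} (C : Matrix (Fin d) (Fin n) ℝ) : Fin n → Fin d → ℝ :=
  fun j i => C i j

/-- The positive solutions of the generalized polynomial system
`∑_j c_{ij} x^{a_j} = 0`, `i = 1, …, d`, where `x^{a} = ∏_l x_l ^ a_l`. -/
def positiveSolutions {d n : ℕ} (a : Fin n → Fin d → ℝ) (C : Matrix (Fin d) (Fin n) ℝ) :
    Set (Fin d → ℝ) :=
  {x | (∀ l, 0 < x l) ∧ ∀ i, ∑ j, C i j * ∏ l, x l ^ a j l = 0}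

/-- The (possibly infinite) number of positive solutions of the system with support `a` and
coefficient matrix `C`. -/
noncomputable def numPositiveSolutions {d n : ℕ} (a : Fin n → Fin d → ℝ)
    (C : Matrix (Fin d) (Fin n) ℝ) : ℕ∞ :=
  (positiveSolutions a C).encard

/-- The positive cone `ℝ_{>0} p_1 + ⋯ + ℝ_{>0} p_n` generated by a configuration. -/
def openCone {d n : ℕ} (p : Fin n → Fin d → ℝ) : Set (Fin d → ℝ) :=
  {v | ∃ w : Fin n → ℝ, (∀ j, 0 < w j) ∧ v = ∑ j, w j • p j}

/-- `N ∈ ℝ^{s × (s-r)}` is a Gale dual matrix of `M ∈ ℝ^{r × s}`: the columns of `N` form a basis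
of the kernel of `M`. The rows of `N` and the columns of `M` are indexed by the same finite type
`ι` with `s` elements. -/
def IsGaleDual {r : ℕ} {ι : Type*} [Fintype ι] (M : Matrix (Fin r) ι ℝ)
    (N : Matrix ι (Fin (Fintype.card ι - r)) ℝ) : Prop :=
  M.rank = r ∧ LinearIndependent ℝ N.col ∧
    Submodule.span ℝ (Set.range N.col) = LinearMap.ker M.mulVecLin

/-- The submatrix of `M` with row set `R` and column set `S` is mixed: each of its columns has a
positive and a negative entry. -/
def IsMixedOn {ι κ : Type*} (M : Matrix ι κ ℝ) (R : Finset ι) (S : Finset κ) : Prop :=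
  ∀ s ∈ S, (∃ i ∈ R, 0 < M i s) ∧ (∃ i ∈ R, M i s < 0)

/-- A matrix is mixed if each of its columns has a positive and a negative entry. -/
def IsMixed {ι κ : Type*} [Fintype ι] [Fintype κ] (M : Matrix ι κ ℝ) : Prop :=
  IsMixedOn M Finset.univ Finset.univ

/-- A matrix is dominating if it contains no (nonempty) square mixed submatrix. -/
def IsDominating {ι κ : Type*} (M : Matrix ι κ ℝ) : Prop :=
  ∀ (R : Finset ι) (S : Finset κ), S.Nonempty → R.card = S.card → ¬ IsMixedOn M R S

/-- Two matrices have the same sign pattern. -/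
def SameSignPattern {ι κ : Type*} (M N : Matrix ι κ ℝ) : Prop :=
  ∀ i j, SignType.sign (M i j) = SignType.sign (N i j)

/-- `I`-compatibility of two configurations `a` and `c` of `n` points in `ℝ^d`. -/
structure IsCompatible {d n : ℕ} (I : Finset (Fin n)) (a c : Fin n → Fin d → ℝ) : Prop where
  /-- The matrices of the two restricted configurations admit mixed dominating Gale duals with the
  same sign pattern. -/
  galeDuals : ∃ B D : Matrix I (Fin (Fintype.card I - (d + 1))) ℝ,
    IsGaleDual (configMatrix fun j : I => a j) B ∧
    IsGaleDual (configMatrix fun j : I => c j) D ∧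
    IsMixed B ∧ IsDominating B ∧ IsMixed D ∧ IsDominating D ∧ SameSignPattern B D
  hull_left : convexHull ℝ (a '' I) = convexHull ℝ (Set.range a)
  hull_right : convexHull ℝ (c '' I) = convexHull ℝ (Set.range c)
  simplex : ∀ j, j ∉ I → ∃ J : Finset (Fin n), J ⊆ I ∧ J.card = d + 1 ∧
    a j ∈ convexHull ℝ (a '' J) ∧ c j ∈ convexHull ℝ (c '' J)

/-! Substituting `x = exp y` turns the system into `∑ exp ⟪a_j, y⟫ c_j = 0`. Such a sum is
dominated, far out in a direction `v`, by the terms whose `a_j` are maximal along `v`. If every face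
of `conv c`, exposed by some `u`, is matched by the face of `conv a` with the same indices, exposed
by some `v`, these choices can be glued into a `C¹` map `T` such that the dominant terms along `T u`
all have `⟪c_j, u⟫ > 0`. For large `R` the field `u ↦ ∑ exp ⟪a_j, R T u⟫ c_j` then points outwards
on the unit sphere, so it has a zero by a Brouwer-type argument (`exists_sum_exp_smul_eq_zero`).

Matching faces is the role of compatibility (`IsCompatible.exists_supporting`). A functional
supporting `c` is orthogonal to the columns of `D`, so `D` is mixed on the rows where it is
positive, and so is `B`, having the same signs. Domination and Stiemke's lemma yield a relation
among the rows of `B`, positive exactly there. It lies in the row space of `A_I`, hence is an affine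
functional on `a` with the same zeros in `I`; equality of hulls and uniformity extend this to all
indices. -/

open Polynomial in
theorem exists_polynomial_det_one_add_smul {E : Type*} [NormedAddCommGroup E] [NormedSpace ℝ E]
    [FiniteDimensional ℝ E] (A : E →L[ℝ] E) :
    ∃ p : ℝ[X], p.natDegree ≤ Module.finrank ℝ E ∧
      ∀ t : ℝ, p.eval t = (ContinuousLinearMap.id ℝ E + t • A).det := by
  classical
  let b := Module.finBasis ℝ E
  let M := LinearMap.toMatrix b b (A : E →ₗ[ℝ] E)
  refine ⟨((X : ℝ[X]) • M.map C + (1 : Matrix _ _ ℝ).map C).det, ?_, fun t => ?_⟩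
  · simpa using natDegree_det_X_add_C_le M (1 : Matrix _ _ ℝ)
  · have hM : (Polynomial.evalRingHom t).mapMatrix ((X : ℝ[X]) • M.map C + (1 : Matrix _ _ ℝ).map C)
        = 1 + t • M := by
      ext i j
      simp [Matrix.one_apply, apply_ite, add_comm]
      exact mul_comm _ _
    rw [← Polynomial.coe_evalRingHom, RingHom.map_det, hM, ContinuousLinearMap.det,
      ← LinearMap.det_toMatrix b]
    congr 1
    simp [M]

/-- Lagrange interpolation at nodes in `[0, ε)`: an identity known only for small parameters can be
carried to the parameter `1`. -/
theorem exists_weights_sum_eval_eq (d : ℕ) {ε : ℝ} (hε : 0 < ε) :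
    ∃ (t c : Fin (d + 1) → ℝ), (∀ i, 0 ≤ t i ∧ t i < ε) ∧
      ∀ p : Polynomial ℝ, p.natDegree ≤ d → p.eval 1 = ∑ i, c i * p.eval (t i) := by
  classical
  let t : Fin (d + 1) → ℝ := fun i => ε * (i : ℝ) / (d + 1)
  have ht : Function.Injective t := by
    intro i j hij
    have h1 : ε * (i : ℝ) / (d + 1) = ε * (j : ℝ) / (d + 1) := hij
    field_simp at h1
    exact Fin.ext (by exact_mod_cast h1)
  refine ⟨t, fun i => (Lagrange.basis Finset.univ t i).eval 1, fun i => ⟨by positivity, ?_⟩,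
    fun p hp => ?_⟩
  · have : (i : ℝ) < d + 1 := by exact_mod_cast i.2
    show ε * (i : ℝ) / (d + 1) < ε
    rw [div_lt_iff₀ (by positivity)]
    gcongr
  · have h := Lagrange.eq_interpolate (s := Finset.univ) (v := t) (f := p) ht.injOn
      (by
        refine lt_of_le_of_lt Polynomial.degree_le_natDegree ?_
        simp only [Finset.card_univ, Fintype.card_fin]
        exact_mod_cast Nat.lt_succ_of_le hp)
    conv_lhs => rw [h]
    rw [Lagrange.interpolate_apply, Polynomial.eval_finsetSum]
    refine Finset.sum_congr rfl fun i _ => ?_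
    simp [mul_comm]

/-! ### No-retraction theorem by a volume argument, and zeros of outward fields -/

section Retraction

variable {E : Type*} [NormedAddCommGroup E] [InnerProductSpace ℝ E]

/-- A Lipschitz map on the closed unit ball that vanishes on the unit sphere extends by zero to a
Lipschitz map. -/
theorem LipschitzOnWith.indicator_closedBall {g : E → E} {K : NNReal}
    (hg : LipschitzOnWith K g (Metric.closedBall 0 1)) (h0 : ∀ x, ‖x‖ = 1 → g x = 0) :
    LipschitzWith K ((Metric.closedBall (0 : E) 1).indicator g) := by
  have key : ∀ x y : E, ‖x‖ ≤ 1 → 1 < ‖y‖ → dist (g x) 0 ≤ K * dist x y := by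
    intro x y hx hy
    -- The segment from `x` to `y` crosses the sphere, where `g` vanishes; the Lipschitz bound is
    -- applied up to that point.
    have hc : ContinuousOn (fun θ : ℝ => ‖AffineMap.lineMap x y θ‖) (Set.Icc 0 1) := by
      apply Continuous.continuousOn
      exact (AffineMap.lineMap_continuous).norm
    obtain ⟨θ, hθ, hθ1⟩ := intermediate_value_Icc zero_le_one hc
      (show (1 : ℝ) ∈ Set.Icc _ _ by simpa using ⟨hx, hy.le⟩)
    simp only at hθ1
    have h1 := hg.dist_le_mul x (by simpa using hx) (AffineMap.lineMap x y θ) (by simp [hθ1])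
    rw [h0 _ hθ1, dist_left_lineMap, Real.norm_of_nonneg hθ.1] at h1
    refine h1.trans ?_
    gcongr
    exact mul_le_of_le_one_left dist_nonneg hθ.2
  refine LipschitzWith.of_dist_le_mul fun x y => ?_
  by_cases hx : ‖x‖ ≤ 1 <;> by_cases hy : ‖y‖ ≤ 1
  · rw [Set.indicator_of_mem (by simpa using hx), Set.indicator_of_mem (by simpa using hy)]
    exact hg.dist_le_mul x (by simpa using hx) y (by simpa using hy)
  · rw [Set.indicator_of_mem (by simpa using hx), Set.indicator_of_notMem (by simpa using hy)]
    exact key x y hx (not_le.1 hy)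
  · rw [Set.indicator_of_notMem (by simpa using hx), Set.indicator_of_mem (by simpa using hy),
      dist_comm, dist_comm x]
    exact key y x hy (not_le.1 hx)
  · rw [Set.indicator_of_notMem (by simpa using hx), Set.indicator_of_notMem (by simpa using hy)]
    simp; positivity

/-- Small perturbations of the identity that fix the complement of the unit ball map the unit ball
onto itself. -/
theorem image_ball_add_smul_of_lipschitz [CompleteSpace E] {g : E → E} {K : NNReal}
    (hg : LipschitzOnWith K g (Metric.closedBall 0 1)) (h0 : ∀ x, ‖x‖ = 1 → g x = 0)
    {t : ℝ} (ht : 0 ≤ t) (htK : t * K < 1) :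
    Set.InjOn (fun x => x + t • g x) (Metric.ball 0 1) ∧
      (fun x => x + t • g x) '' Metric.ball 0 1 = Metric.ball 0 1 := by
  -- Extending by zero makes `x + t G x` a bijection of `E`, since `t K < 1`. It is the identity
  -- outside the open ball, so it must permute the ball.
  set G := (Metric.closedBall (0 : E) 1).indicator g with hG
  have hL : LipschitzWith K G := hg.indicator_closedBall h0
  have happ : ApproximatesLinearOn (fun x => x + t • G x)
      ((ContinuousLinearEquiv.refl ℝ E : E ≃L[ℝ] E) : E →L[ℝ] E) Set.univ (t.toNNReal * K) := by
    intro x _ y _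
    have h1 := hL.dist_le_mul x y
    rw [dist_eq_norm, dist_eq_norm] at h1
    have : x + t • G x - (y + t • G y) -
        ((ContinuousLinearEquiv.refl ℝ E : E ≃L[ℝ] E) : E →L[ℝ] E) (x - y) = t • (G x - G y) := by
      simp [smul_sub]; abel
    rw [this, norm_smul, Real.norm_of_nonneg ht, NNReal.coe_mul, Real.coe_toNNReal _ ht, mul_assoc]
    gcongr
  have hc : Subsingleton E ∨
      t.toNNReal * K < ‖((ContinuousLinearEquiv.refl ℝ E).symm : E →L[ℝ] E)‖₊⁻¹ := by
    rcases subsingleton_or_nontrivial E with h | h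
    · exact Or.inl h
    · right
      have : ‖((ContinuousLinearEquiv.refl ℝ E).symm : E →L[ℝ] E)‖₊ = 1 := by
        rw [← NNReal.coe_inj]
        exact ContinuousLinearMap.norm_id
      rw [this, inv_one, ← NNReal.coe_lt_coe]
      simpa [Real.coe_toNNReal _ ht] using htK
  have hinj : Function.Injective fun x => x + t • G x :=
    Set.injOn_univ.1 (happ.injOn hc)
  have hsurj := happ.surjective hc
  have hout : ∀ x : E, 1 ≤ ‖x‖ → x + t • G x = x := by
    intro x hx
    rcases hx.eq_or_lt with h | h
    · rw [hG, Set.indicator_of_mem (by simp [← h]), h0 x h.symm]; simp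
    · rw [hG, Set.indicator_of_notMem (by simpa using h)]; simp
  have hin : ∀ x ∈ Metric.ball (0 : E) 1, x + t • g x = x + t • G x := by
    intro x hx
    rw [hG, Set.indicator_of_mem (Metric.ball_subset_closedBall hx)]
  refine ⟨fun x hx y hy hxy => ?_, ?_⟩
  · simp only [hin x hx, hin y hy] at hxy
    exact hinj hxy
  · ext y
    constructor
    · rintro ⟨x, hx, rfl⟩
      simp only [hin x hx]
      by_contra hy
      have hy' : 1 ≤ ‖x + t • G x‖ := by simpa using hy
      have : x + t • G x = x := hinj (hout _ hy')
      rw [this] at hy'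
      have hx' : ‖x‖ < 1 := by simpa using hx
      linarith
    · intro hy
      obtain ⟨x, hx⟩ := hsurj y
      simp only at hx
      have hxb : x ∈ Metric.ball (0 : E) 1 := by
        by_contra hxn
        have hx' : 1 ≤ ‖x‖ := by simpa using hxn
        rw [hout x hx'] at hx
        exact hxn (hx ▸ hy)
      exact ⟨x, hxb, by simp only [hin x hxb, hx]⟩

variable [FiniteDimensional ℝ E]

/-- Differentiating `‖r‖² = 1` shows that the range of the derivative is orthogonal to `r x ≠ 0`. -/
theorem det_fderiv_eq_zero_of_norm_eq_one {r : E → E} {x : E} (hr : DifferentiableAt ℝ r x)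
    (h1 : ∀ᶠ y in nhds x, ‖r y‖ = 1) : (fderiv ℝ r x).det = 0 := by
  have hd : HasFDerivAt (fun y => inner ℝ (r y) (r y)) _ x :=
    hr.hasFDerivAt.inner ℝ hr.hasFDerivAt
  have hd0 : HasFDerivAt (fun y => inner ℝ (r y) (r y)) (0 : E →L[ℝ] ℝ) x := by
    refine (hasFDerivAt_const (1 : ℝ) x).congr_of_eventuallyEq ?_
    filter_upwards [h1] with y hy
    simp [hy]
  have heq := hd.unique hd0
  by_contra hdet
  have hu : IsUnit (fderiv ℝ r x : E →ₗ[ℝ] E) :=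
    (LinearMap.isUnit_iff_isUnit_det _).2 (isUnit_iff_ne_zero.2 hdet)
  obtain ⟨v, hv⟩ := ((Module.End.isUnit_iff _).1 hu).2 (r x)
  have hv' : fderiv ℝ r x v = r x := hv
  have := DFunLike.congr_fun heq v
  simp [hv', h1.self_of_nhds] at this

/-- With `g = r - id`, the integral of `det (id + t Dg)` over the ball is a polynomial in `t`. For
small `t` it is the volume of the ball, by change of variables; at `t = 1` it is `∫ det Dr = 0`. -/
theorem not_exists_retraction_sphere [Nontrivial E] (r : E → E)
    (hr : ∀ x ∈ Metric.closedBall (0 : E) 1, ContDiffAt ℝ 1 r x)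
    (h1 : ∀ x ∈ Metric.closedBall (0 : E) 1, ‖r x‖ = 1)
    (hid : ∀ x, ‖x‖ = 1 → r x = x) : False := by
  classical
  let : MeasurableSpace E := borel E
  have : BorelSpace E := ⟨rfl⟩
  let μ : MeasureTheory.Measure E := MeasureTheory.volume
  set g : E → E := fun x => r x - x with hgdef
  have hg0 : ∀ x, ‖x‖ = 1 → g x = 0 := fun x hx => by simp [hgdef, hid x hx]
  have hgd : ∀ x ∈ Metric.closedBall (0 : E) 1, ContDiffAt ℝ 1 g x :=
    fun x hx => (hr x hx).sub contDiffAt_id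
  have hdiff : ∀ x ∈ Metric.closedBall (0 : E) 1, DifferentiableAt ℝ g x :=
    fun x hx => (hgd x hx).differentiableAt (by simp)
  have hcont : ContinuousOn (fderiv ℝ g) (Metric.closedBall (0 : E) 1) := fun x hx =>
    ((hgd x hx).continuousAt_fderiv (by simp)).continuousWithinAt
  have hcpt : IsCompact (Metric.closedBall (0 : E) 1) := isCompact_closedBall 0 1
  obtain ⟨K', hK'⟩ := hcpt.exists_bound_of_continuousOn hcont
  set K : NNReal := K'.toNNReal with hK
  have hKb : ∀ x ∈ Metric.closedBall (0 : E) 1, ‖fderiv ℝ g x‖ ≤ K :=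
    fun x hx => (hK' x hx).trans (Real.le_coe_toNNReal K')
  have hLip : LipschitzOnWith K g (Metric.closedBall 0 1) :=
    (convex_closedBall 0 1).lipschitzOnWith_of_nnnorm_fderiv_le hdiff
      (fun x hx => by exact_mod_cast hKb x hx)
  have hdetc : Continuous (fun A : E →L[ℝ] E => (ContinuousLinearMap.id ℝ E + A).det) :=
    ContinuousLinearMap.continuous_det.comp (continuous_const.add continuous_id)
  have hnear : ∀ᶠ A : E →L[ℝ] E in nhds 0, 0 < (ContinuousLinearMap.id ℝ E + A).det := by
    refine hdetc.continuousAt.eventually_const_lt ?_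
    simp [ContinuousLinearMap.det]
  obtain ⟨δ, hδ, hδdet⟩ := Metric.eventually_nhds_iff.1 hnear
  have hK0 : (0 : ℝ) ≤ K := K.2
  -- The bound `1` gives bijectivity on the ball, `δ` gives positive determinants; `K + 1` avoids
  -- division by zero.
  obtain ⟨t, c, ht, htc⟩ := exists_weights_sum_eval_eq (Module.finrank ℝ E)
    (show 0 < min 1 δ / (K + 1) by positivity)
  have htK : ∀ i, t i * K < min 1 δ := fun i => by
    have h2 := (lt_div_iff₀ (by positivity)).1 (ht i).2
    nlinarith [(ht i).1]
  have hnormt : ∀ i, ∀ x ∈ Metric.closedBall (0 : E) 1, ‖t i • fderiv ℝ g x‖ < δ := by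
    intro i x hx
    rw [norm_smul, Real.norm_of_nonneg (ht i).1]
    calc t i * ‖fderiv ℝ g x‖ ≤ t i * K := by gcongr; exacts [(ht i).1, hKb x hx]
      _ < δ := (htK i).trans_le (min_le_right _ _)
  have hvol : ∀ i, ∫ x in Metric.ball (0 : E) 1,
      (ContinuousLinearMap.id ℝ E + t i • fderiv ℝ g x).det ∂μ = μ.real (Metric.ball 0 1) := by
    intro i
    obtain ⟨hinj, himg⟩ := image_ball_add_smul_of_lipschitz hLip hg0 (ht i).1
      ((htK i).trans_le (min_le_left _ _))
    have h := MeasureTheory.integral_image_eq_integral_abs_det_fderiv_smul μ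
      (s := Metric.ball (0 : E) 1) (f := fun x => x + t i • g x)
      (f' := fun x => ContinuousLinearMap.id ℝ E + t i • fderiv ℝ g x)
      Metric.isOpen_ball.measurableSet
      (fun x hx => ((hasFDerivAt_id x).add
        ((hdiff x (Metric.ball_subset_closedBall hx)).hasFDerivAt.const_smul
          (t i))).hasFDerivWithinAt) hinj (fun _ => (1 : ℝ))
    rw [himg] at h
    simp only [smul_eq_mul, mul_one, MeasureTheory.integral_const,
      MeasureTheory.measureReal_restrict_apply_univ] at h
    rw [h]
    refine MeasureTheory.setIntegral_congr_fun Metric.isOpen_ball.measurableSet fun x hx => ?_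
    refine (abs_of_pos (hδdet ?_)).symm
    simpa using hnormt i x (Metric.ball_subset_closedBall hx)
  have hint : ∀ s : ℝ, MeasureTheory.IntegrableOn
      (fun x => (ContinuousLinearMap.id ℝ E + s • fderiv ℝ g x).det) (Metric.ball 0 1) μ := by
    intro s
    refine MeasureTheory.IntegrableOn.mono_set ?_ Metric.ball_subset_closedBall
    refine ContinuousOn.integrableOn_compact hcpt ?_
    exact hdetc.comp_continuousOn (hcont.const_smul s)
  have hpoly : ∀ x, (ContinuousLinearMap.id ℝ E + (1 : ℝ) • fderiv ℝ g x).det =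
      ∑ i, c i * (ContinuousLinearMap.id ℝ E + t i • fderiv ℝ g x).det := by
    intro x
    obtain ⟨p, hp, hpe⟩ := exists_polynomial_det_one_add_smul (fderiv ℝ g x)
    simpa only [hpe] using htc p hp
  have hsumc : ∑ i, c i = 1 := by simpa using (htc 1 (by simp)).symm
  have hone : ∫ x in Metric.ball (0 : E) 1,
      (ContinuousLinearMap.id ℝ E + (1 : ℝ) • fderiv ℝ g x).det ∂μ
        = μ.real (Metric.ball 0 1) := by
    simp only [hpoly]
    rw [MeasureTheory.integral_finsetSum _ fun i _ => (hint (t i)).const_mul (c i)]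
    simp only [MeasureTheory.integral_const_mul, hvol, ← Finset.sum_mul, hsumc, one_mul]
  have hzero : ∫ x in Metric.ball (0 : E) 1,
      (ContinuousLinearMap.id ℝ E + (1 : ℝ) • fderiv ℝ g x).det ∂μ = 0 := by
    refine MeasureTheory.setIntegral_eq_zero_of_forall_eq_zero fun x hx => ?_
    have hxc := Metric.ball_subset_closedBall hx
    have hrd : DifferentiableAt ℝ r x := (hr x hxc).differentiableAt (by simp)
    have : ContinuousLinearMap.id ℝ E + (1 : ℝ) • fderiv ℝ g x = fderiv ℝ r x := by
      rw [one_smul, hgdef, fderiv_fun_sub hrd differentiableAt_fun_id, fderiv_fun_id]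
      abel
    rw [this]
    refine det_fderiv_eq_zero_of_norm_eq_one hrd ?_
    filter_upwards [Metric.isOpen_ball.mem_nhds hx] with y hy
    exact h1 y (Metric.ball_subset_closedBall hy)
  have hpos : 0 < μ.real (Metric.ball (0 : E) 1) :=
    ENNReal.toReal_pos (Metric.measure_ball_pos μ 0 one_pos).ne' MeasureTheory.measure_ball_lt_top.ne
  linarith

/-- A `C¹` vector field that points outwards on the unit sphere has a zero. -/
theorem exists_eq_zero_of_inner_pos_on_sphere {Φ : E → E} (hΦ : ContDiff ℝ 1 Φ)
    (hout : ∀ u, ‖u‖ = 1 → 0 < inner ℝ (Φ u) u) : ∃ u, Φ u = 0 := by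
  rcases subsingleton_or_nontrivial E with hE | hE
  · exact ⟨0, Subsingleton.elim _ _⟩
  by_contra! hne
  -- The retraction follows `Φ x` from `x` to the sphere: `s x` is the larger root of `‖x + s Φ x‖²
  -- = 1` and `ρ x` its reduced discriminant. Outwardness makes `ρ > 0` and `s = 0` on the sphere.
  set ρ : E → ℝ := fun x => inner ℝ (Φ x) x ^ 2 + ‖Φ x‖ ^ 2 * (1 - ‖x‖ ^ 2) with hρ
  set s : E → ℝ := fun x => (√(ρ x) - inner ℝ (Φ x) x) / ‖Φ x‖ ^ 2 with hs
  have hρpos : ∀ x ∈ Metric.closedBall (0 : E) 1, 0 < ρ x := by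
    intro x hx
    have hx' : ‖x‖ ≤ 1 := by simpa using hx
    have hΦx : 0 < ‖Φ x‖ := norm_pos_iff.2 (hne x)
    rcases hx'.eq_or_lt with h | h
    · have := hout x h
      simp only [hρ, h]
      nlinarith
    · have : 0 < 1 - ‖x‖ ^ 2 := by nlinarith [norm_nonneg x]
      simp only [hρ]
      positivity
  have hnsq : ∀ x, ‖x + s x • Φ x‖ ^ 2 =
      ‖x‖ ^ 2 + 2 * (s x * inner ℝ (Φ x) x) + s x ^ 2 * ‖Φ x‖ ^ 2 := by
    intro x
    rw [norm_add_sq_real, inner_smul_right, real_inner_comm, norm_smul, mul_pow, Real.norm_eq_abs,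
      sq_abs]
  refine not_exists_retraction_sphere (fun x => x + s x • Φ x) (fun x hx => ?_) (fun x hx => ?_)
    (fun x hx => ?_)
  · have h1 : ContDiffAt ℝ 1 (fun x => inner ℝ (Φ x) x) x :=
      (hΦ.contDiffAt).inner ℝ contDiffAt_id
    have h2 : ContDiffAt ℝ 1 (fun x => ‖Φ x‖ ^ 2) x := hΦ.contDiffAt.norm_sq ℝ
    have h3 : ContDiffAt ℝ 1 (fun x : E => ‖x‖ ^ 2) x := contDiffAt_id.norm_sq ℝ
    have h4 : ContDiffAt ℝ 1 ρ x := (h1.pow 2).add (h2.mul (contDiffAt_const.sub h3))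
    have h5 : ContDiffAt ℝ 1 s x := ((h4.sqrt (hρpos x hx).ne').sub h1).div h2
      (by have := norm_pos_iff.2 (hne x); positivity)
    exact contDiffAt_id.add (h5.smul hΦ.contDiffAt)
  · have hΦx : 0 < ‖Φ x‖ := norm_pos_iff.2 (hne x)
    have hsq := Real.sq_sqrt (hρpos x hx).le
    have hsx : s x * ‖Φ x‖ ^ 2 = √(ρ x) - inner ℝ (Φ x) x := by
      simp only [hs]; field_simp
    have : ‖x + s x • Φ x‖ ^ 2 = 1 := by
      have h6 : (‖x + s x • Φ x‖ ^ 2 - 1) * ‖Φ x‖ ^ 2 = 0 := by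
        rw [hnsq]
        have h7 : ρ x = inner ℝ (Φ x) x ^ 2 + ‖Φ x‖ ^ 2 * (1 - ‖x‖ ^ 2) := rfl
        linear_combination (s x * ‖Φ x‖ ^ 2 + √(ρ x) + inner ℝ (Φ x) x) * hsx + hsq + h7
      rcases mul_eq_zero.1 h6 with h | h
      · linarith
      · exact absurd h (by positivity)
    have h8 := norm_nonneg (x + s x • Φ x)
    nlinarith
  · have hsx : s x = 0 := by
      simp only [hs, hρ, hx]
      norm_num
      left
      rw [Real.sqrt_sq (hout x hx).le, sub_self]
    simp [hsx]

end Retraction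

/-! ### Mixed dominating matrices and Stiemke's lemma -/

section Dominating

variable {ι κ : Type*} [Fintype κ]

/-- A nonzero vector in the column space of a mixed dominating matrix has a negative entry. -/
theorem IsDominating.exists_mulVec_neg {B : Matrix ι κ ℝ} (hB : IsDominating B) {Q : Finset ι}
    (hQ : IsMixedOn B Q Finset.univ) {μ : κ → ℝ} (hμ : μ ≠ 0) : ∃ k ∈ Q, B.mulVec μ k < 0 := by
  classical
  by_contra! hnn
  set M : ι → κ → ℝ := fun k s => B k s * μ s with hM
  set S₀ : Finset κ := Finset.univ.filter fun s => μ s ≠ 0 with hS₀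
  have hneg : ∀ s, μ s ≠ 0 → ∃ k ∈ Q, M k s < 0 := by
    intro s hs
    obtain ⟨⟨i, hi, hi'⟩, ⟨j, hj, hj'⟩⟩ := hQ s (Finset.mem_univ s)
    rcases lt_or_gt_of_ne hs with h | h
    · exact ⟨i, hi, mul_neg_of_pos_of_neg hi' h⟩
    · exact ⟨j, hj, mul_neg_of_neg_of_pos hj' h⟩
  have hpos : ∀ k ∈ Q, (∃ s, M k s < 0) → ∃ s, 0 < M k s := by
    rintro k hk ⟨s, hs⟩
    by_contra! hle
    have : B.mulVec μ k < 0 := by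
      rw [Matrix.mulVec, dotProduct]
      exact Finset.sum_neg' (fun i _ => hle i) ⟨s, Finset.mem_univ s, hs⟩
    exact absurd (hnn k hk) (not_le.2 this)
  obtain ⟨s₁, hs₁⟩ := Function.ne_iff.1 hμ
  have : Nonempty κ := ⟨s₁⟩
  have : Nonempty ι := ⟨(hneg s₁ hs₁).choose⟩
  -- From a column `s`, go to a row `r s` where `M` is negative, then to a column `p (r s)` where
  -- that row is positive. On a minimal nonempty invariant set of columns this map is a permutation,
  -- so the visited rows and columns form a forbidden square mixed submatrix.
  choose! r hrQ hr using hneg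
  choose! p hp using hpos
  have hne : S₀.Nonempty := ⟨s₁, by simpa [hS₀] using hs₁⟩
  have hmem : ∀ s ∈ S₀, μ s ≠ 0 := fun s hs => by simpa [hS₀] using hs
  have hf : ∀ s, μ s ≠ 0 → 0 < M (r s) (p (r s)) := fun s hs =>
    hp (r s) (hrQ s hs) ⟨s, hr s hs⟩
  have hfS : ∀ s ∈ S₀, p (r s) ∈ S₀ := fun s hs => by
    have := hf s (hmem s hs)
    simp only [hS₀, Finset.mem_filter, Finset.mem_univ, true_and]
    intro h0
    simp [hM, h0] at this
  obtain ⟨S, hS⟩ := (Set.toFinite {S : Finset κ | S.Nonempty ∧ S ⊆ S₀ ∧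
    S.image (fun s => p (r s)) ⊆ S}).exists_minimal
    ⟨S₀, hne, subset_rfl, Finset.image_subset_iff.2 hfS⟩
  obtain ⟨⟨hSne, hSS, hSf⟩, hmin⟩ := hS
  have himg : S ⊆ S.image (fun s => p (r s)) :=
    hmin ⟨hSne.image _, hSf.trans hSS, Finset.image_subset_image hSf⟩ hSf
  have hinj : Set.InjOn (fun s => p (r s)) S :=
    Finset.card_image_iff.1 (by rw [hSf.antisymm himg])
  have hrinj : Set.InjOn r S := fun s hs s' hs' h => hinj hs hs' (by simp only [h])
  refine hB (S.image r) S hSne (Finset.card_image_of_injOn hrinj) fun s hs => ?_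
  have h1 : M (r s) s < 0 := hr s (hmem s (hSS hs))
  obtain ⟨s', hs', h2⟩ := Finset.mem_image.1 (himg hs)
  have h3 : 0 < M (r s') s := h2 ▸ hf s' (hmem s' (hSS hs'))
  have hm1 : r s ∈ S.image r := Finset.mem_image_of_mem r hs
  have hm2 : r s' ∈ S.image r := Finset.mem_image_of_mem r hs'
  rcases lt_or_gt_of_ne (hmem s (hSS hs)) with h | h
  · exact ⟨⟨_, hm1, pos_of_mul_neg_left h1 h.le⟩, ⟨_, hm2, neg_of_mul_pos_left h3 h.le⟩⟩
  · exact ⟨⟨_, hm2, pos_of_mul_pos_left h3 h.le⟩, ⟨_, hm1, neg_of_mul_neg_left h1 h.le⟩⟩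

/-- A form of Stiemke's lemma: the rows of a matrix have a positive linear relation as soon as
every nonzero vector in its column space has a negative entry. -/
theorem exists_pos_vecMul_eq_zero [Fintype ι] {B : Matrix ι κ ℝ} {Q : Finset ι}
    (h : ∀ μ : κ → ℝ, μ ≠ 0 → ∃ k ∈ Q, B.mulVec μ k < 0) :
    ∃ w : ι → ℝ, (∀ k ∈ Q, 0 < w k) ∧ (∀ k ∉ Q, w k = 0) ∧ Matrix.vecMul w B = 0 := by
  classical
  let L : (Q → ℝ) →ₗ[ℝ] (κ → ℝ) := (B.submatrix (Subtype.val : Q → ι) id).vecMulLinear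
  have hdual : ∀ f : (κ → ℝ) →ₗ[ℝ] ℝ, ∀ k : Q,
      f (L (Pi.single k 1)) = B.mulVec (fun s => f (Pi.single s 1)) k := by
    intro f k
    have h1 : L (Pi.single k 1) = fun s => B k s := by
      ext s; simp [L]
    rw [h1, LinearMap.pi_apply_eq_sum_univ]
    refine Finset.sum_congr rfl fun s _ => ?_
    rw [smul_eq_mul]
    congr 2
    ext j
    simp [Pi.single_apply, eq_comm]
  have hfz : ∀ f : (κ → ℝ) →ₗ[ℝ] ℝ, (fun s => f (Pi.single s 1)) = 0 → f = 0 := by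
    intro f hf
    refine LinearMap.pi_ext' fun s => LinearMap.ext_ring ?_
    simpa using congrFun hf s
  have hsurj : Function.Surjective L := by
    rw [← LinearMap.dualMap_injective_iff]
    refine (injective_iff_map_eq_zero _).2 fun f hf => hfz f ?_
    by_contra hne
    obtain ⟨k, hk, hlt⟩ := h _ hne
    rw [← hdual f ⟨k, hk⟩] at hlt
    have := DFunLike.congr_fun hf (Pi.single ⟨k, hk⟩ 1)
    rw [LinearMap.dualMap_apply] at this
    rw [this] at hlt
    simp at hlt
  -- The image of the open orthant is open by surjectivity. If it missed `0`, a separating `f` would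
  -- be nonpositive on the rows in `Q`, and `-f` would give a nonzero `μ` contradicting `h`.
  set P : Set (Q → ℝ) := Set.univ.pi fun _ => Set.Ioi 0 with hP
  have hPo : IsOpen P := isOpen_set_pi Set.finite_univ fun _ _ => isOpen_Ioi
  have hPc : Convex ℝ P := convex_pi fun _ _ => convex_Ioi 0
  by_cases h0 : (0 : κ → ℝ) ∈ L '' P
  · obtain ⟨w, hw, hw0⟩ := h0
    refine ⟨fun k => if hk : k ∈ Q then w ⟨k, hk⟩ else 0, fun k hk => ?_, fun k hk => by simp [hk],
      ?_⟩
    · simpa [hk] using hw ⟨k, hk⟩ (Set.mem_univ _)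
    · rw [← hw0]
      ext s
      simp only [Matrix.vecMul, dotProduct, L, Matrix.vecMulLinear_apply, Matrix.submatrix_apply, id]
      rw [← Finset.sum_subset (Finset.subset_univ Q) (fun k _ hk => by simp [hk]),
        ← Finset.sum_coe_sort Q]
      exact Finset.sum_congr rfl fun k _ => by simp
  · exfalso
    obtain ⟨f, hf⟩ := geometric_hahn_banach_open_point (hPc.linear_image L)
      (L.isOpenMap_of_finiteDimensional hsurj P hPo) h0
    rw [map_zero] at hf
    have hle : ∀ k : Q, f (L (Pi.single k 1)) ≤ 0 := by
      intro k
      have hlim : Filter.Tendsto (fun ε : ℝ => f (L (Pi.single k 1 + ε • 1)))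
          (nhdsWithin 0 (Set.Ioi 0)) (nhds (f (L (Pi.single k 1)))) := by
        have hc : Continuous fun ε : ℝ => f (L (Pi.single k 1 + ε • 1)) :=
          f.continuous.comp (L.continuous_of_finiteDimensional.comp (by fun_prop))
        have := (hc.tendsto 0).mono_left (nhdsWithin_le_nhds (s := Set.Ioi 0))
        simpa using this
      refine le_of_tendsto hlim ?_
      filter_upwards [self_mem_nhdsWithin] with ε hε
      refine (hf _ (Set.mem_image_of_mem _ fun i _ => ?_)).le
      have h1 : (0 : ℝ) ≤ (Pi.single k 1 : Q → ℝ) i := by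
        by_cases hik : i = k <;> simp [hik]
      have hε' : (0 : ℝ) < ε := hε
      simp only [Set.mem_Ioi, Pi.add_apply, Pi.smul_apply, Pi.one_apply, smul_eq_mul, mul_one]
      linarith
    have hne : (fun s => (-f.toLinearMap) (Pi.single s 1)) ≠ 0 := by
      intro hz
      have h1 := hfz _ hz
      have h2 := hf _ (Set.mem_image_of_mem L (show (1 : Q → ℝ) ∈ P from fun i _ => by simp))
      have h3 := DFunLike.congr_fun h1 (L 1)
      simp at h3
      linarith
    obtain ⟨k, hk, hlt⟩ := h _ hne
    rw [← hdual (-f.toLinearMap) ⟨k, hk⟩] at hlt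
    have := hle ⟨k, hk⟩
    simp only [LinearMap.neg_apply, ContinuousLinearMap.coe_coe] at hlt
    linarith

end Dominating

/-- The row space is the annihilator of the kernel; this turns a relation among the rows of a Gale
dual into an affine functional. -/
theorem mem_range_vecMul_of_forall_ker {r : ℕ} {ι : Type*} [Fintype ι] (M : Matrix (Fin r) ι ℝ)
    (w : ι → ℝ) (h : ∀ v, M.mulVec v = 0 → ∑ k, w k * v k = 0) :
    ∃ x, Matrix.vecMul x M = w := by
  classical
  let φ : Module.Dual ℝ (ι → ℝ) := Fintype.linearCombination ℝ w
  have hφ : ∀ v, φ v = ∑ k, w k * v k := fun v => by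
    simp [φ, Fintype.linearCombination_apply, mul_comm]
  have hmem : φ ∈ (LinearMap.ker M.mulVecLin).dualAnnihilator := by
    rw [Submodule.mem_dualAnnihilator]
    intro v hv
    rw [hφ]
    exact h v (by simpa using hv)
  rw [← LinearMap.range_dualMap_eq_dualAnnihilator_ker] at hmem
  obtain ⟨ψ, hψ⟩ := hmem
  refine ⟨fun i => ψ (Pi.single i 1), ?_⟩
  ext k
  have h1 : φ (Pi.single k 1) = w k := by simp [hφ, Pi.single_apply]
  rw [← h1, ← hψ, LinearMap.dualMap_apply,
    LinearMap.pi_apply_eq_sum_univ ψ (M.mulVecLin (Pi.single k 1)),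
    Matrix.vecMul, dotProduct]
  refine Finset.sum_congr rfl fun i _ => ?_
  have h2 : (M.mulVecLin (Pi.single k 1)) i = M i k := by simp
  rw [h2, smul_eq_mul, mul_comm]
  congr 2
  ext j
  simp [Pi.single_apply, eq_comm]

/-! ### Uniform matrices: general position of rows and kernel vectors -/

section Uniform

variable {r n : ℕ} {M : Matrix (Fin r) (Fin n) ℝ}

theorem IsUniform.eq_zero_of_vecMul (hM : IsUniform M) {x : Fin r → ℝ} {Z : Finset (Fin n)}
    (hZ : r ≤ Z.card) (h : ∀ j ∈ Z, Matrix.vecMul x M j = 0) : x = 0 := by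
  let f := Z.orderEmbOfCardLe hZ
  refine Matrix.eq_zero_of_vecMul_eq_zero (hM f.toEmbedding) ?_
  ext i
  exact h (f i) (Finset.orderEmbOfCardLe_mem Z hZ i)

theorem IsUniform.card_lt_of_vecMul (hM : IsUniform M) {x : Fin r → ℝ} (hx : x ≠ 0)
    {Z : Finset (Fin n)} (h : ∀ j ∈ Z, Matrix.vecMul x M j = 0) : Z.card < r := by
  by_contra! hZ
  exact hx (hM.eq_zero_of_vecMul hZ h)

theorem IsUniform.eq_zero_of_mulVec (hM : IsUniform M) (hrn : r ≤ n) {w : Fin n → ℝ}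
    {S : Finset (Fin n)} (hS : S.card ≤ r) (hw : ∀ j ∉ S, w j = 0) (h : M.mulVec w = 0) :
    w = 0 := by
  obtain ⟨T, hST, hT⟩ := Finset.exists_superset_card_eq hS (by simpa using hrn)
  let f := T.orderEmbOfFin hT
  have hfT : Finset.univ.map f.toEmbedding = T := by simp [f]
  have hwT : ∀ j ∉ T, w j = 0 := fun j hj => hw j fun h => hj (hST h)
  have h0 : (fun i => w (f i)) = 0 := by
    refine Matrix.eq_zero_of_mulVec_eq_zero (hM f.toEmbedding) ?_
    rw [← h]
    ext k
    simp only [Matrix.mulVec, dotProduct, Matrix.submatrix_apply, id]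
    rw [← Finset.sum_subset (Finset.subset_univ T) (fun j _ hj => by simp [hwT j hj]), ← hfT,
      Finset.sum_map]
    rfl
  ext j
  by_cases hj : j ∈ T
  · rw [← hfT] at hj
    obtain ⟨i, _, rfl⟩ := Finset.mem_map.1 hj
    exact congrFun h0 i
  · exact hwT j hj

end Uniform

/-! ### Affine functionals, Gale duals and the correspondence of faces -/

section Config

variable {d n : ℕ}

theorem vecMul_configMatrix {ι : Type*} (p : ι → Fin d → ℝ) (x : Fin (d + 1) → ℝ) (j : ι) :
    Matrix.vecMul x (configMatrix p) j = x 0 + ∑ i, x i.succ * p j i := by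
  simp [Matrix.vecMul, dotProduct, configMatrix, Fin.sum_univ_succ]

theorem exists_weights_of_mem_convexHull_image {ι E : Type*} [Fintype ι] [AddCommGroup E]
    [Module ℝ E] {p : ι → E} {I : Finset ι} {y : E} (hy : y ∈ convexHull ℝ (p '' I)) :
    ∃ w : ι → ℝ, (∀ k, 0 ≤ w k) ∧ (∀ k ∉ I, w k = 0) ∧ ∑ k, w k = 1 ∧ ∑ k, w k • p k = y := by
  classical
  revert hy
  suffices hsub : convexHull ℝ (p '' I) ⊆ {y | ∃ w : ι → ℝ, (∀ k, 0 ≤ w k) ∧ (∀ k ∉ I, w k = 0) ∧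
      ∑ k, w k = 1 ∧ ∑ k, w k • p k = y} from fun hy => hsub hy
  refine convexHull_min ?_ ?_
  · rintro _ ⟨k, hk, rfl⟩
    refine ⟨Pi.single k 1, fun i => ?_, fun i hi => ?_, by simp, by simp [Pi.single_apply]⟩
    · by_cases h : i = k <;> simp [h]
    · have : i ≠ k := fun h => hi (h ▸ hk)
      simp [this]
  · rintro _ ⟨w, hw, hwI, hw1, rfl⟩ _ ⟨v, hv, hvI, hv1, rfl⟩ α β hα hβ hαβ
    refine ⟨fun k => α * w k + β * v k, fun k => ?_, fun k hk => by simp [hwI k hk, hvI k hk], ?_,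
      ?_⟩
    · have := hw k
      have := hv k
      positivity
    · rw [Finset.sum_add_distrib, ← Finset.mul_sum, ← Finset.mul_sum, hw1, hv1]
      simpa using hαβ
    · simp only [add_smul, mul_smul, Finset.sum_add_distrib, Finset.smul_sum]

/-- If the points indexed by `I` have the same convex hull as a uniform configuration, then an
affine functional that is nonnegative on `I` is nonnegative everywhere and vanishes only on `I`. -/
theorem nonneg_and_mem_of_convexHull_eq {p : Fin n → Fin d → ℝ} (hp : IsUniform (configMatrix p))
    (hdn : d + 1 ≤ n) {I : Finset (Fin n)}
    (hI : convexHull ℝ (p '' I) = convexHull ℝ (Set.range p)) {x : Fin (d + 1) → ℝ} (hx : x ≠ 0)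
    (hnn : ∀ k ∈ I, 0 ≤ Matrix.vecMul x (configMatrix p) k) (j : Fin n) :
    0 ≤ Matrix.vecMul x (configMatrix p) j ∧
      (Matrix.vecMul x (configMatrix p) j = 0 → j ∈ I) := by
  classical
  have hj : p j ∈ convexHull ℝ (p '' I) := by
    rw [hI]; exact subset_convexHull ℝ _ (Set.mem_range_self j)
  obtain ⟨w, hw0, hwI, hw1, hwp⟩ := exists_weights_of_mem_convexHull_image hj
  set g := Matrix.vecMul x (configMatrix p) with hg
  have hker : (configMatrix p).mulVec (w - Pi.single j 1) = 0 := by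
    rw [Matrix.mulVec_sub]
    ext i
    refine Fin.cases ?_ (fun i => ?_) i
    · simp [Matrix.mulVec, dotProduct, configMatrix, hw1]
    · have := congrFun hwp i
      simp only [Finset.sum_apply, Pi.smul_apply, smul_eq_mul] at this
      simp [Matrix.mulVec, dotProduct, configMatrix, ← this, mul_comm]
  have hgj : g j = ∑ k, g k * w k := by
    have h1 : g ⬝ᵥ (w - Pi.single j 1) = 0 := by
      rw [hg, ← Matrix.dotProduct_mulVec, hker, dotProduct_zero]
    rw [dotProduct_sub] at h1
    simp only [dotProduct_single, mul_one] at h1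
    linarith [show g ⬝ᵥ w = ∑ k, g k * w k from rfl]
  have hterm : ∀ k, 0 ≤ g k * w k := by
    intro k
    by_cases hk : k ∈ I
    · exact mul_nonneg (hnn k hk) (hw0 k)
    · simp [hwI k hk]
  refine ⟨hgj ▸ Finset.sum_nonneg fun k _ => hterm k, fun h0 => ?_⟩
  by_contra hjI
  rw [hgj, Finset.sum_eq_zero_iff_of_nonneg fun k _ => hterm k] at h0
  have hcard : (Finset.univ.filter fun k => g k = 0).card < d + 1 :=
    hp.card_lt_of_vecMul hx fun k hk => by simpa using hk
  have hgj0 : g j = 0 := by rw [hgj]; exact Finset.sum_eq_zero h0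
  -- The kernel vector `w - e_j` is supported on the zeros of `g`, of which there are at most `d`,
  -- so it vanishes; yet its entry at `j ∉ I` is `-1`.
  have hz := hp.eq_zero_of_mulVec hdn hcard.le (w := w - Pi.single j 1) (fun k hk => by
    have hk' : g k ≠ 0 := by simpa using hk
    have hkj : k ≠ j := fun h => hk' (h ▸ hgj0)
    have := (mul_eq_zero.1 (h0 k (Finset.mem_univ k))).resolve_left hk'
    simp [this, hkj]) hker
  have := congrFun hz j
  simp [hwI j hjI] at this

/-- A column of a Gale dual on which a nonnegative row relation is nonzero only on `Q` has entries
of both signs in `Q`. -/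
theorem isMixedOn_of_isGaleDual {p : Fin n → Fin d → ℝ} (hp : IsUniform (configMatrix p))
    (hdn : d + 1 ≤ n) {I : Finset (Fin n)} {D : Matrix I (Fin (Fintype.card I - (d + 1))) ℝ}
    (hD : IsGaleDual (configMatrix fun j : I => p j) D) {x : Fin (d + 1) → ℝ} (hx : x ≠ 0)
    (hnn : ∀ k ∈ I, 0 ≤ Matrix.vecMul x (configMatrix p) k) :
    IsMixedOn D (Finset.univ.filter fun k : I => Matrix.vecMul x (configMatrix p) k ≠ 0)
      Finset.univ := by
  classical
  obtain ⟨-, hind, hspan⟩ := hD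
  set g := Matrix.vecMul x (configMatrix p) with hg
  intro s _
  have hker : (configMatrix fun j : I => p j).mulVec (D.col s) = 0 := by
    have : D.col s ∈ LinearMap.ker (configMatrix fun j : I => p j).mulVecLin :=
      hspan ▸ Submodule.subset_span (Set.mem_range_self s)
    simpa using this
  have hgI : Matrix.vecMul x (configMatrix fun j : I => p j) = fun k : I => g k := by
    ext k; rw [hg, vecMul_configMatrix, vecMul_configMatrix]
  have hsum : ∑ k : I, g k * D k s = 0 := by
    have : (fun k : I => g k) ⬝ᵥ D.col s = 0 := by
      rw [← hgI, ← Matrix.dotProduct_mulVec, hker, dotProduct_zero]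
    exact this
  -- Otherwise this basis column would be a kernel vector supported on at most `d` indices, hence
  -- zero.
  have hnz : ¬ ∀ k : I, g k ≠ 0 → D k s = 0 := by
    intro hall
    set w : Fin n → ℝ := fun j => if hj : j ∈ I then D ⟨j, hj⟩ s else 0 with hw
    have hcard : (Finset.univ.filter fun k => g k = 0).card < d + 1 :=
      hp.card_lt_of_vecMul hx fun k hk => by simpa using hk
    have hw0 : w = 0 := by
      refine hp.eq_zero_of_mulVec hdn hcard.le (fun j hj => ?_) ?_
      · by_cases hjI : j ∈ I
        · simpa [hw, hjI] using hall ⟨j, hjI⟩ (by simpa using hj)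
        · simp [hw, hjI]
      · rw [← hker]
        ext i
        simp only [Matrix.mulVec, dotProduct, hw, configMatrix, Matrix.of_apply]
        rw [← Finset.sum_subset (Finset.subset_univ I) (fun k _ hk => by simp [hk]),
          ← Finset.sum_coe_sort I]
        exact Finset.sum_congr rfl fun k _ => by simp [Matrix.col]
    refine hind.ne_zero s ?_
    ext k
    have := congrFun hw0 k
    simpa [hw] using this
  have hgn : ∀ k : I, 0 ≤ g k := fun k => hnn k k.2
  constructor
  · by_contra! hle
    refine hnz fun k hk => ?_
    have h1 : ∀ k : I, g k * D k s ≤ 0 := fun k => by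
      by_cases hk : g k = 0
      · simp [hk]
      · exact mul_nonpos_of_nonneg_of_nonpos (hgn k) (hle k (by simpa using hk))
    have h2 := (Finset.sum_eq_zero_iff_of_nonpos fun k _ => h1 k).1 hsum k (Finset.mem_univ k)
    exact (mul_eq_zero.1 h2).resolve_left hk
  · by_contra! hle
    refine hnz fun k hk => ?_
    have h1 : ∀ k : I, 0 ≤ g k * D k s := fun k => by
      by_cases hk : g k = 0
      · simp [hk]
      · exact mul_nonneg (hgn k) (hle k (by simpa using hk))
    have h2 := (Finset.sum_eq_zero_iff_of_nonneg fun k _ => h1 k).1 hsum k (Finset.mem_univ k)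
    exact (mul_eq_zero.1 h2).resolve_left hk

/-- Faces correspond under compatibility: every proper face of the second configuration is cut out
by a supporting functional of the first one. -/
theorem IsCompatible.exists_supporting {I : Finset (Fin n)} {a c : Fin n → Fin d → ℝ}
    (h : IsCompatible I a c) (ha : IsUniform (configMatrix a)) (hc : IsUniform (configMatrix c))
    (hdn : d + 1 ≤ n) {x : Fin (d + 1) → ℝ} (hx : x ≠ 0)
    (hnn : ∀ k, 0 ≤ Matrix.vecMul x (configMatrix c) k) :
    ∃ x' : Fin (d + 1) → ℝ, ∀ k, 0 ≤ Matrix.vecMul x' (configMatrix a) k ∧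
      (Matrix.vecMul x' (configMatrix a) k = 0 ↔ Matrix.vecMul x (configMatrix c) k = 0) := by
  classical
  obtain ⟨B, D, hB, hD, -, hBd, -, -, hsign⟩ := h.galeDuals
  have hmixD := isMixedOn_of_isGaleDual hc hdn hD hx fun k _ => hnn k
  set Q : Finset I := Finset.univ.filter fun k : I => Matrix.vecMul x (configMatrix c) k ≠ 0 with hQ
  have hmixB : IsMixedOn B Q Finset.univ := by
    intro s hs
    obtain ⟨⟨i, hi, hi'⟩, ⟨j, hj, hj'⟩⟩ := hmixD s hs
    refine ⟨⟨i, hi, ?_⟩, ⟨j, hj, ?_⟩⟩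
    · rw [← sign_eq_one_iff] at hi' ⊢
      rw [hsign, hi']
    · rw [← sign_eq_neg_one_iff] at hj' ⊢
      rw [hsign, hj']
  obtain ⟨w, hwQ, hw0, hwB⟩ := exists_pos_vecMul_eq_zero fun μ hμ => hBd.exists_mulVec_neg hmixB hμ
  have hspan : Submodule.span ℝ (Set.range B.col) ≤
      LinearMap.ker (Fintype.linearCombination ℝ w : (I → ℝ) →ₗ[ℝ] ℝ) := by
    rw [Submodule.span_le]
    rintro _ ⟨s, rfl⟩
    simpa [Fintype.linearCombination_apply, Matrix.vecMul, dotProduct, mul_comm] using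
      congrFun hwB s
  obtain ⟨x', hx'⟩ := mem_range_vecMul_of_forall_ker (configMatrix fun j : I => a j) w (by
    intro v hv
    have hv' : v ∈ Submodule.span ℝ (Set.range B.col) := by
      rw [hB.2.2]; simpa using hv
    simpa [Fintype.linearCombination_apply, mul_comm] using hspan hv')
  have hxI : ∀ k : I, Matrix.vecMul x' (configMatrix a) k = w k := by
    intro k
    rw [← hx', vecMul_configMatrix, vecMul_configMatrix]
  have hcardI : d + 1 ≤ I.card := by
    have := Matrix.rank_le_card_width (configMatrix fun j : I => a j)
    rwa [hB.1, Fintype.card_coe] at this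
  have hw : ∀ k : I, 0 ≤ w k ∧ (w k = 0 ↔ Matrix.vecMul x (configMatrix c) k = 0) := by
    intro k
    by_cases hk : k ∈ Q
    · exact ⟨(hwQ k hk).le, iff_of_false (hwQ k hk).ne' (by simpa [hQ] using hk)⟩
    · exact ⟨(hw0 k hk).ge, iff_of_true (hw0 k hk) (by simpa [hQ] using hk)⟩
  -- If `x'` were zero, `x` would vanish on all of `I`, which has at least `d + 1` elements because
  -- `A_I` has full rank.
  have hxne : x' ≠ 0 := by
    rintro rfl
    refine hx (hc.eq_zero_of_vecMul hcardI fun j hj => ?_)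
    refine (hw ⟨j, hj⟩).2.1 ?_
    rw [← hxI]
    simp
  have hexta := nonneg_and_mem_of_convexHull_eq ha hdn h.hull_left hxne fun k hk => by
    rw [hxI ⟨k, hk⟩]; exact (hw ⟨k, hk⟩).1
  have hextc := nonneg_and_mem_of_convexHull_eq hc hdn h.hull_right hx fun k _ => hnn k
  refine ⟨x', fun k => ⟨(hexta k).1, ?_⟩⟩
  by_cases hk : k ∈ I
  · rw [hxI ⟨k, hk⟩]
    exact (hw ⟨k, hk⟩).2
  · exact iff_of_false (fun h0 => hk ((hexta k).2 h0)) (fun h0 => hk ((hextc k).2 h0))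

end Config

/-! ### Exponential sums with matching faces -/

section Exponential

open Filter Topology

variable {E ι : Type*} [NormedAddCommGroup E] [InnerProductSpace ℝ E] [FiniteDimensional ℝ E]
  [Fintype ι]

/-- The indices at which the linear functional `⟪·, v⟫` is maximal on the configuration `a`. -/
def maxFace (a : ι → E) (v : E) : Set ι :=
  {j | ∀ k, inner ℝ (a k) v ≤ inner ℝ (a j) v}

omit [FiniteDimensional ℝ E] in
theorem maxFace_nonempty [Nonempty ι] (a : ι → E) (v : E) : (maxFace a v).Nonempty :=
  Finite.exists_max fun j => inner ℝ (a j) v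

/-- Faces can only shrink under small changes of `u`, so a `v` matching the face at `u₀` stays
admissible nearby; a smooth partition of unity glues these constants. -/
theorem exists_contDiff_selection {a c : ι → E} (hpos : ∀ u ≠ 0, ∃ j, 0 < inner ℝ (c j) u)
    (hface : ∀ u ≠ 0, ∃ v, maxFace a v = maxFace c u) :
    ∃ T : E → E, ContDiff ℝ 1 T ∧ ∀ u, ‖u‖ = 1 → ∀ j ∈ maxFace a (T u), 0 < inner ℝ (c j) u := by
  -- The inclusion of faces secures convexity: `v` and `v'` share a maximizer, so a maximizer for a
  -- combination is one for each vector with positive weight.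
  let t : E → Set E := fun u =>
    {v | ‖u‖ = 1 → maxFace c u ⊆ maxFace a v ∧ ∀ j ∈ maxFace a v, 0 < inner ℝ (c j) u}
  have hconv : ∀ u, Convex ℝ (t u) := by
    intro u v hv v' hv' α β hα hβ hαβ hu
    obtain ⟨h1, h2⟩ := hv hu
    obtain ⟨h1', h2'⟩ := hv' hu
    have hu0 : u ≠ 0 := by rintro rfl; simp at hu
    have : Nonempty ι := ⟨(hpos u hu0).choose⟩
    have hlin : ∀ j, inner ℝ (a j) (α • v + β • v') = α * inner ℝ (a j) v + β * inner ℝ (a j) v' :=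
      fun j => by rw [inner_add_right, inner_smul_right, inner_smul_right]
    refine ⟨fun j hj k => ?_, fun j hj => ?_⟩
    · rw [hlin, hlin]
      have := h1 hj k
      have := h1' hj k
      gcongr
    · obtain ⟨i, hi⟩ := maxFace_nonempty c u
      have h3 := hj i
      rw [hlin, hlin] at h3
      have h4 := h1 hi
      have h5 := h1' hi
      rcases hα.eq_or_lt with h0 | h0
      · refine h2' j fun k => (h5 k).trans ?_
        have : β = 1 := by linarith
        subst this
        rw [← h0] at h3
        linarith
      · refine h2 j fun k => (h4 k).trans ?_
        have h6 := mul_le_mul_of_nonneg_left (h5 j) hβ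
        exact le_of_mul_le_mul_left (by linarith) h0
  have hloc : ∀ u₀ : E, ∃ v, ∀ᶠ u in 𝓝 u₀, v ∈ t u := by
    intro u₀
    by_cases hu₀ : ‖u₀‖ = 1
    · have hu0 : u₀ ≠ 0 := by rintro rfl; simp at hu₀
      obtain ⟨v, hv⟩ := hface u₀ hu0
      have hcont : ∀ j, ContinuousAt (fun u => inner ℝ (c j) u) u₀ := fun j =>
        (continuous_const.inner continuous_id).continuousAt
      have h1 : ∀ᶠ u in 𝓝 u₀, ∀ j, j ∉ maxFace c u₀ → j ∉ maxFace c u := by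
        refine eventually_all.2 fun j => ?_
        by_cases hj : j ∈ maxFace c u₀
        · simp [hj]
        · obtain ⟨k, hk⟩ : ∃ k, inner ℝ (c j) u₀ < inner ℝ (c k) u₀ := by
            simpa [maxFace] using hj
          filter_upwards [(hcont j).eventually_lt (hcont k) hk] with u hu _ hmem
          exact absurd (hmem k) (not_le.2 hu)
      have h2 : ∀ᶠ u in 𝓝 u₀, ∀ j, j ∈ maxFace c u₀ → 0 < inner ℝ (c j) u := by
        refine eventually_all.2 fun j => ?_
        by_cases hj : j ∈ maxFace c u₀
        · obtain ⟨k, hk⟩ := hpos u₀ hu0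
          filter_upwards [(hcont j).eventually_const_lt (hk.trans_le (hj k))] with u hu _
          exact hu
        · simp [hj]
      refine ⟨v, ?_⟩
      filter_upwards [h1, h2] with u hu1 hu2 _
      rw [hv]
      exact ⟨fun j hj => by_contra fun h => hu1 j h hj, hu2⟩
    · refine ⟨0, ?_⟩
      filter_upwards [continuous_norm.continuousAt.eventually_ne hu₀] with u hu h
      exact absurd h hu
  obtain ⟨g, hg⟩ := exists_contMDiffMap_forall_mem_convex_of_local_const
    (n := 1) (modelWithCornersSelf ℝ E) hconv hloc
  exact ⟨g, g.contMDiff.contDiff, fun u hu => (hg u hu).2⟩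

/-- Existence of a zero of an exponential sum whose coefficient configuration has the same faces as
its exponent configuration. -/
theorem exists_sum_exp_smul_eq_zero {a c : ι → E} (hpos : ∀ u ≠ 0, ∃ j, 0 < inner ℝ (c j) u)
    (hface : ∀ u ≠ 0, ∃ v, maxFace a v = maxFace c u) :
    ∃ y, ∑ j, Real.exp (inner ℝ (a j) y) • c j = 0 := by
  classical
  obtain ⟨T, hT, hTpos⟩ := exists_contDiff_selection hpos hface
  have hloc : ∀ u₀ ∈ Metric.sphere (0 : E) 1, ∀ᶠ z : ℝ × E in atTop ×ˢ 𝓝 u₀,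
      0 < inner ℝ (∑ j, Real.exp (inner ℝ (a j) (z.1 • T z.2)) • c j) z.2 := by
    intro u₀ hu₀
    have hu₀' : ‖u₀‖ = 1 := by simpa using hu₀
    have hu0 : u₀ ≠ 0 := by rintro rfl; simp at hu₀'
    have : Nonempty ι := ⟨(hpos u₀ hu0).choose⟩
    obtain ⟨i, hi⟩ := maxFace_nonempty a (T u₀)
    have hfst : Tendsto (fun z : ℝ × E => z.1) (atTop ×ˢ 𝓝 u₀) atTop := tendsto_fst
    have hsnd : Tendsto (fun z : ℝ × E => z.2) (atTop ×ˢ 𝓝 u₀) (𝓝 u₀) := tendsto_snd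
    have hc : ∀ j, Tendsto (fun z : ℝ × E => inner ℝ (c j) z.2) (atTop ×ˢ 𝓝 u₀)
        (𝓝 (inner ℝ (c j) u₀)) := fun j => tendsto_const_nhds.inner hsnd
    let γ : ι → E → ℝ := fun j u => inner ℝ (a j) (T u) - inner ℝ (a i) (T u)
    have hγ : ∀ j, Tendsto (fun z : ℝ × E => γ j z.2) (atTop ×ˢ 𝓝 u₀) (𝓝 (γ j u₀)) := by
      intro j
      have h1 : Continuous (γ j) := by
        have := hT.continuous
        fun_prop
      exact (h1.tendsto u₀).comp hsnd
    -- A lower bound for the terms, rescaled so that the one at `i` is `⟪c i, u⟫`. Other terms of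
    -- the face at `T u₀` may have no limit, but are eventually nonnegative and are replaced by `0`;
    -- the rest decay.
    let b : ι → ℝ × E → ℝ := fun j z =>
      if j ∈ maxFace a (T u₀) ∧ j ≠ i then 0 else Real.exp (z.1 * γ j z.2) * inner ℝ (c j) z.2
    have hb : ∀ j, Tendsto (b j) (atTop ×ˢ 𝓝 u₀)
        (𝓝 (if j = i then inner ℝ (c i) u₀ else 0)) := by
      intro j
      by_cases hji : j = i
      · subst hji
        have : b j = fun z : ℝ × E => inner ℝ (c j) z.2 := by
          ext z; simp [b, γ]
        rw [this, if_pos rfl]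
        exact hc j
      · rw [if_neg hji]
        by_cases hj : j ∈ maxFace a (T u₀)
        · have : b j = fun _ => 0 := by ext z; simp [b, hj, hji]
          rw [this]
          exact tendsto_const_nhds
        · have : b j = fun z : ℝ × E => Real.exp (z.1 * γ j z.2) * inner ℝ (c j) z.2 := by
            ext z; simp [b, hj]
          rw [this, ← zero_mul (inner ℝ (c j) u₀)]
          refine Tendsto.mul (Real.tendsto_exp_atBot.comp ?_) (hc j)
          refine hfst.atTop_mul_neg ?_ (hγ j)
          obtain ⟨k, hk⟩ : ∃ k, inner ℝ (a j) (T u₀) < inner ℝ (a k) (T u₀) := by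
            simpa [maxFace] using hj
          have := hi k
          simp only [γ]
          linarith
    have hsum : Tendsto (fun z => ∑ j, b j z) (atTop ×ˢ 𝓝 u₀) (𝓝 (inner ℝ (c i) u₀)) := by
      simpa using tendsto_finsetSum Finset.univ fun j _ => hb j
    have hnn : ∀ᶠ z : ℝ × E in atTop ×ˢ 𝓝 u₀, ∀ j, j ∈ maxFace a (T u₀) → 0 < inner ℝ (c j) z.2 := by
      refine eventually_all.2 fun j => ?_
      by_cases hj : j ∈ maxFace a (T u₀)
      · filter_upwards [(hc j).eventually_const_lt (hTpos u₀ hu₀' j hj)] with z hz _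
        exact hz
      · simp [hj]
    filter_upwards [hsum.eventually_const_lt (hTpos u₀ hu₀' i hi), hnn] with z hz hz'
    have heq : inner ℝ (∑ j, Real.exp (inner ℝ (a j) (z.1 • T z.2)) • c j) z.2 =
        Real.exp (z.1 * inner ℝ (a i) (T z.2)) *
          ∑ j, Real.exp (z.1 * γ j z.2) * inner ℝ (c j) z.2 := by
      rw [sum_inner, Finset.mul_sum]
      refine Finset.sum_congr rfl fun j _ => ?_
      rw [real_inner_smul_left, inner_smul_right, ← mul_assoc, ← Real.exp_add]
      congr 2
      simp only [γ]
      ring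
    rw [heq]
    refine mul_pos (Real.exp_pos _) (hz.trans_le (Finset.sum_le_sum fun j _ => ?_))
    simp only [b]
    split_ifs with h
    · exact mul_nonneg (Real.exp_pos _).le (hz' j h.1).le
    · exact le_rfl
  -- Compactness of the sphere gives one `R` valid for all `u`.
  have hev : ∀ᶠ z : ℝ × E in atTop ×ˢ 𝓝ˢ (Metric.sphere (0 : E) 1),
      0 < inner ℝ (∑ j, Real.exp (inner ℝ (a j) (z.1 • T z.2)) • c j) z.2 := by
    rw [(isCompact_sphere (0 : E) 1).prod_nhdsSet_eq_biSup]
    simpa only [eventually_iSup] using hloc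
  obtain ⟨R, hR⟩ := (hev.curry.mono fun R hR => hR.self_of_nhdsSet).exists
  have hsmooth : ContDiff ℝ 1 fun u => ∑ j, Real.exp (inner ℝ (a j) (R • T u)) • c j :=
    ContDiff.sum fun j _ =>
      ((contDiff_const.inner ℝ (contDiff_const.smul hT)).exp).smul contDiff_const
  obtain ⟨u, hu⟩ := exists_eq_zero_of_inner_pos_on_sphere hsmooth fun u hu =>
    hR u (by simpa using hu)
  exact ⟨R • T u, hu⟩

end Exponential

/-! ### The main theorem -/

theorem theorem5p6 (d n : ℕ) (hn : d + 2 ≤ n)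
    (a : Fin n → Fin d → ℝ) (C : Matrix (Fin d) (Fin n) ℝ)
    (hA : IsUniform (configMatrix a)) (hC : IsUniform C)
    (hCbar : IsUniform (configMatrix (colConfig C)))
    (h0 : (0 : Fin d → ℝ) ∈ openCone (colConfig C))
    (hI : ∃ I : Finset (Fin n), IsCompatible I a (colConfig C)) :
    0 < numPositiveSolutions a C := by
  obtain ⟨I, hI⟩ := hI
  have : Nonempty (Fin n) := ⟨⟨0, by omega⟩⟩
  have hinner : ∀ (p : Fin n → Fin d → ℝ) j (u : EuclideanSpace ℝ (Fin d)),
      inner ℝ (WithLp.toLp 2 (p j)) u = ∑ i, u i * p j i := fun p j u => by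
    simp [PiLp.inner_apply]
  have hpos : ∀ u : EuclideanSpace ℝ (Fin d), u ≠ 0 →
      ∃ j, 0 < inner ℝ (WithLp.toLp 2 (colConfig C j)) u := by
    intro u hu
    by_contra! hle
    obtain ⟨w, hw, hw0⟩ := h0
    have hvec : ∀ j, inner ℝ (WithLp.toLp 2 (colConfig C j)) u = Matrix.vecMul u C j :=
      fun j => hinner _ j u
    have hsum : ∑ j, w j * inner ℝ (WithLp.toLp 2 (colConfig C j)) u = 0 := by
      have h1 : ∑ j, w j • WithLp.toLp 2 (colConfig C j) = (0 : EuclideanSpace ℝ (Fin d)) := by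
        ext i
        simpa using (congrFun hw0 i).symm
      simp only [← real_inner_smul_left]
      rw [← sum_inner, h1, inner_zero_left]
    have hz := (Finset.sum_eq_zero_iff_of_nonpos fun j _ =>
      mul_nonpos_of_nonneg_of_nonpos (hw j).le (hle j)).1 hsum
    refine hu ?_
    have := hC.eq_zero_of_vecMul (x := u) (Z := Finset.univ) (by simp; omega) fun j hj => by
      rw [← hvec]
      exact (mul_eq_zero.1 (hz j hj)).resolve_left (hw j).ne'
    ext i
    exact congrFun this i
  have hface : ∀ u : EuclideanSpace ℝ (Fin d), u ≠ 0 → ∃ v : EuclideanSpace ℝ (Fin d),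
      maxFace (fun j => WithLp.toLp 2 (a j)) v =
        maxFace (fun j => WithLp.toLp 2 (colConfig C j)) u := by
    intro u hu
    obtain ⟨i, hi⟩ := maxFace_nonempty
      (fun j => (WithLp.toLp 2 (colConfig C j) : EuclideanSpace ℝ (Fin d))) u
    let m : ℝ := inner ℝ (WithLp.toLp 2 (colConfig C i)) u
    -- As an affine functional this is `m - ⟪·, u⟫`, nonnegative on `c` and zero exactly on the face
    -- exposed by `u`.
    let x : Fin (d + 1) → ℝ := Fin.cons m fun l => -u l
    have hx : x ≠ 0 := by
      intro h
      refine hu ?_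
      ext l
      have := congrFun h l.succ
      simpa [x] using this
    have hval : ∀ k, Matrix.vecMul x (configMatrix (colConfig C)) k =
        m - inner ℝ (WithLp.toLp 2 (colConfig C k)) u := fun k => by
      rw [vecMul_configMatrix, hinner]
      simp [x, sub_eq_add_neg]
    obtain ⟨x', hx'⟩ := hI.exists_supporting hA hCbar (by omega) hx fun k => by
      rw [hval]; exact sub_nonneg.2 (hi k)
    let v : EuclideanSpace ℝ (Fin d) := WithLp.toLp 2 fun l => -x' l.succ
    have hval' : ∀ k, Matrix.vecMul x' (configMatrix a) k =
        x' 0 - inner ℝ (WithLp.toLp 2 (a k)) v := fun k => by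
      rw [vecMul_configMatrix, hinner]
      simp [v, sub_eq_add_neg]
    simp only [hval, hval'] at hx'
    have hi' : inner ℝ (WithLp.toLp 2 (a i)) v = x' 0 := by
      have := (hx' i).2.2 (sub_self m)
      linarith
    refine ⟨v, Set.ext fun j => ⟨fun hj k => ?_, fun hj k => ?_⟩⟩
    · have h1 := (hx' j).2.1 (le_antisymm (by have := hj i; simp only at this; linarith) (hx' j).1)
      have := hi k
      simp only at this
      linarith
    · have h1 := (hx' j).2.2 (le_antisymm (by have := hj i; simp only at this; linarith)
        (sub_nonneg.2 (hi j)))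
      have := (hx' k).1
      simp only
      linarith
  obtain ⟨y, hy⟩ := exists_sum_exp_smul_eq_zero hpos hface
  rw [numPositiveSolutions, Set.encard_pos]
  refine ⟨fun l => Real.exp (y l), fun l => Real.exp_pos _, fun i => ?_⟩
  have h1 : ∀ j, ∏ l, Real.exp (y l) ^ a j l =
      Real.exp (inner ℝ (WithLp.toLp 2 (a j)) y) := fun j => by
    rw [hinner, Real.exp_sum]
    exact Finset.prod_congr rfl fun l _ => (Real.exp_mul _ _).symm
  have h2 := congrArg (fun z : EuclideanSpace ℝ (Fin d) => z i) hy
  simp only [h1]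
  simpa [colConfig, mul_comm] using h2
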